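/- Let $d\ge 2$, and let $P(\mathbb R^d)$ be the space of lines through the origin in $\mathbb R^d$, with its usual topology. An infinite measure preserving $\mathbb Z^d$-action is an action $T=(T_\gamma)_{\gamma\in\mathbb Z^d}$ by measure preserving transformations of a standard Borel space $X$ with a nonatomic $\sigma$-finite measure $\mu$ such that $\mu(X)=\infty$. It is free if $T_\gamma x\neq x$ for all $\gamma\ne 0$ and $x\in X$. It is of rank one (by cubes) if there are measurable sets $B_n$ with $0<\mu(B_n)<\infty$ and cubes $F_n=\{0,\dots,h_n-1\}^d$, $h_n\geq 1$ ($n\ge 0$), such that for each $n$ the levels $T_fB_n$, $f\in F_n$, are pairwise disjoint; for each $n$ there is $C_{n+1}\subset\mathbb Z^d$ with $F_n+C_{n+1}\subset F_{n+1}$ and $B_n=\bigcup_{c\in C_{n+1}}T_cB_{n+1}$; and for each measurable $A$ with $\mu(A)<\infty$ and each $\varepsilon>0$, for all large $n$ some union of levels $\bigcup_{f\in S}T_fB_n$, $S\subset F_n$, satisfies $\mu\big(A\,\triangle\bigcup_{f\in S}T_fB_n\big)<\varepsilon$. The action $T$ is recurrent along a line $\theta\in P(\mathbb R^d)$ if for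 each $\varepsilon>0$ and each measurable $A$ with $\mu(A)>0$ there are $\gamma\in\mathbb Z^d\setminus\{0\}$ and $g\in\theta$ with $\|\gamma-g\|<\varepsilon$ (Euclidean norm) and $\mu(A\cap T_\gamma A)>0$. Let $\mathcal R(T)\subset P(\mathbb R^d)$ be the set of lines along which $T$ is recurrent. Theorem. Let $\Delta$ be any $G_\delta$ subset of $P(\mathbb R^d)$ and let $D\subset\Delta$ be countable. Then there is a rank-one, free, infinite measure preserving $\mathbb Z^d$-action $T$ with $D\subset\mathcal R(T)\subset\Delta$. In particular, every countable $G_\delta$ subset of $P(\mathbb R^d)$ (for example the empty set, or any countable compact set) equals $\mathcal R(T)$ for some such $T$. -/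

import Mathlib

open MeasureTheory Set Filter
open scoped ENNReal symmDiff LinearAlgebra.Projectivization

/-- The usual topology on the projective space of a real topological vector space `V`: the quotient
topology with respect to the projection of the nonzero vectors onto the lines they span. -/
noncomputable instance projectivizationTopology (V : Type*) [AddCommGroup V] [Module ℝ V] [TopologicalSpace V] :
    TopologicalSpace (ℙ ℝ V) :=
  TopologicalSpace.coinduced (Projectivization.mk' ℝ) inferInstance

/-- The projective space of lines through the origin in Euclidean space `ℝ^d`. -/
abbrev ProjSpace (d : ℕ) : Type := ℙ ℝ (EuclideanSpace ℝ (Fin d))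

/-- The inclusion of the lattice `ℤ^d` in Euclidean space `ℝ^d`. -/
noncomputable def latticePoint {d : ℕ} (γ : Fin d → ℤ) : EuclideanSpace ℝ (Fin d) :=
  WithLp.toLp 2 (fun i => (γ i : ℝ))

/-- The cube `{0, …, h - 1}^d` in `ℤ^d`. -/
def latticeCube (d h : ℕ) : Set (Fin d → ℤ) :=
  {f | ∀ i, 0 ≤ f i ∧ f i < (h : ℤ)}

/-- An infinite measure preserving action of `ℤ^d`: a measure preserving action `T` on a standard
Borel space with a nonatomic `σ`-finite measure `μ` of infinite total mass. -/
structure InfiniteMPAction (d : ℕ) where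
  /-- the underlying space -/
  X : Type
  [measurableSpace : MeasurableSpace X]
  [standardBorel : StandardBorelSpace X]
  /-- the invariant measure -/
  μ : Measure X
  [sigmaFinite : SigmaFinite μ]
  [nullSingleton : NullSingletonClass μ]
  measure_univ : μ univ = ∞
  /-- the transformations `T γ`, for `γ` in `ℤ^d` -/
  T : (Fin d → ℤ) → X → X
  map_zero : ∀ x, T 0 x = x
  map_add : ∀ γ γ' x, T (γ + γ') x = T γ (T γ' x)
  measurePreserving : ∀ γ, MeasurePreserving (T γ) μ μ

namespace InfiniteMPAction

attribute [instance] measurableSpace standardBorel sigmaFinite nullSingleton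

variable {d : ℕ} (T : InfiniteMPAction d)

/-- The action is free: no nonzero element of `ℤ^d` fixes a point. -/
def IsFree : Prop :=
  ∀ γ : Fin d → ℤ, γ ≠ 0 → ∀ x, T.T γ x ≠ x

/-- The action is of rank one (by cubes): there is a sequence of Rokhlin towers, with bases `B n` of
positive finite measure and with shapes the cubes `{0, …, h n - 1}^d`, such that
the levels `T f (B n)` of each tower are pairwise disjoint, each tower is cut into
translates of the base of the next tower and sits inside that next tower (cutting and stacking), and
the levels generate: every measurable set of finite measure is approximated
arbitrarily well, for all large `n`, by unions of levels of the `n`-th tower. -/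
def IsRankOne : Prop :=
  ∃ (h : ℕ → ℕ) (B : ℕ → Set T.X),
    (∀ n, 0 < h n ∧ MeasurableSet (B n) ∧ 0 < T.μ (B n) ∧ T.μ (B n) < ∞) ∧
    (∀ n, (latticeCube d (h n)).PairwiseDisjoint (fun f => T.T f '' B n)) ∧
    (∀ n, ∃ C : Set (Fin d → ℤ),
      (∀ f ∈ latticeCube d (h n), ∀ c ∈ C, f + c ∈ latticeCube d (h (n + 1))) ∧
      B n = ⋃ c ∈ C, T.T c '' B (n + 1)) ∧
    (∀ A : Set T.X, MeasurableSet A → T.μ A < ∞ → ∀ ε : ℝ≥0∞, 0 < ε →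
      ∀ᶠ n in atTop, ∃ S ⊆ latticeCube d (h n), T.μ (A ∆ ⋃ f ∈ S, T.T f '' B n) < ε)

/-- The action is recurrent along the line `θ`: for every `ε > 0` and every measurable set `A` of
positive measure there are a nonzero `γ` in `ℤ^d` and a point `g` of `θ` with `dist γ g < ε` and
`μ (A ∩ T γ A) > 0`. -/
def IsRecurrentAlong (θ : ProjSpace d) : Prop :=
  ∀ ε : ℝ, 0 < ε → ∀ A : Set T.X, MeasurableSet A → 0 < T.μ A →
    ∃ γ : Fin d → ℤ, γ ≠ 0 ∧ ∃ g ∈ θ.submodule,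
      dist (latticePoint γ) g < ε ∧ 0 < T.μ (A ∩ T.T γ '' A)

/-- The set of all lines along which the action is recurrent. -/
def recurrenceSet : Set (ProjSpace d) :=
  {θ | T.IsRecurrentAlong θ}

end InfiniteMPAction

/-! The action is built on `ℝ` with Lebesgue measure by cutting and stacking. Each level of tower
`n` is cut into two halves, placed in the next cube at displacements `a n` and `a n + t n`; the
remaining cells of that cube are filled with fresh dyadic intervals. The margins around both copies
grow with `n`, so every translation is eventually defined at every point, and freeness holds without
discarding a null set.

The vectors `t n` control recurrence. On each level of stage `n`, `T (t n)` carries the left half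
onto the right half, so by Lebesgue density every set of positive measure meets its image under `T
(t n)` for all large `n` (`eventually_volume_inter_image_act_t_pos`). Conversely, a nonzero return
time to a base of stage `n` is `± t k`, for some `k ≥ n`, plus a difference of two points of cube
`k` (`exists_eq_t_add_of_level_inter_nonempty`).

Choose `t k` very close to `s • u k` with `s` huge compared with the cube. Then `T` recurs along a
line containing `u k` for infinitely many `k`, and only along lines meeting the ball of radius `r k`
about `u k` for infinitely many `k` (`exists_action_of_directions`). It remains to pick lines `p k`
in open sets `O k` so that every point of `D` occurs infinitely often and the upper limit of the `O
k` lies in `Δ` (`exists_points_of_isGδ`). -/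

/-! ### Dyadic intervals of the line -/

/-- The index `k` of the dyadic interval `[k / 2 ^ n, (k + 1) / 2 ^ n)` that contains `x`. -/
noncomputable def dyadicIndex (n : ℕ) (x : ℝ) : ℤ := ⌊(2 : ℝ) ^ n * x⌋

/-- The relative position of `x` in the dyadic interval of order `n` that contains it. -/
noncomputable def dyadicFract (n : ℕ) (x : ℝ) : ℝ := Int.fract ((2 : ℝ) ^ n * x)

lemma dyadicIndex_add_fract (n : ℕ) (x : ℝ) :
    (dyadicIndex n x : ℝ) + dyadicFract n x = 2 ^ n * x :=
  Int.floor_add_fract _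

lemma dyadicFract_nonneg (n : ℕ) (x : ℝ) : 0 ≤ dyadicFract n x := Int.fract_nonneg _

lemma dyadicFract_lt_one (n : ℕ) (x : ℝ) : dyadicFract n x < 1 := Int.fract_lt_one _

lemma measurable_dyadicIndex (n : ℕ) : Measurable (dyadicIndex n) :=
  Int.measurable_floor.comp (measurable_const_mul _)

lemma measurable_dyadicFract (n : ℕ) : Measurable (dyadicFract n) :=
  measurable_fract.comp (measurable_const_mul _)

lemma eq_of_dyadic_eq {n : ℕ} {x y : ℝ} (h₁ : dyadicIndex n x = dyadicIndex n y)
    (h₂ : dyadicFract n x = dyadicFract n y) : x = y := by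
  have h := dyadicIndex_add_fract n x
  rw [h₁, h₂, dyadicIndex_add_fract] at h
  exact (mul_left_cancel₀ (by positivity) h).symm

lemma dyadicIndex_div {n : ℕ} (k : ℤ) {r : ℝ} (h₀ : 0 ≤ r) (h₁ : r < 1) :
    dyadicIndex n ((k + r) / 2 ^ n) = k := by
  rw [dyadicIndex, mul_div_cancel₀ _ (by positivity), Int.floor_eq_iff]
  constructor <;> linarith

lemma dyadicFract_div {n : ℕ} (k : ℤ) {r : ℝ} (h₀ : 0 ≤ r) (h₁ : r < 1) :
    dyadicFract n ((k + r) / 2 ^ n) = r := by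
  rw [dyadicFract, mul_div_cancel₀ _ (by positivity), Int.fract_intCast_add,
    Int.fract_eq_self.2 ⟨h₀, h₁⟩]

lemma dyadicIndex_succ (n : ℕ) (x : ℝ) :
    dyadicIndex (n + 1) x = 2 * dyadicIndex n x + ⌊2 * dyadicFract n x⌋ := by
  have h : (2 : ℝ) ^ (n + 1) * x = ((2 * dyadicIndex n x : ℤ) : ℝ) + 2 * dyadicFract n x := by
    push_cast
    rw [← mul_add, dyadicIndex_add_fract]; ring
  rw [dyadicIndex, h, Int.floor_intCast_add]

lemma dyadicFract_succ (n : ℕ) (x : ℝ) :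
    dyadicFract (n + 1) x = Int.fract (2 * dyadicFract n x) := by
  have h : (2 : ℝ) ^ (n + 1) * x = ((2 * dyadicIndex n x : ℤ) : ℝ) + 2 * dyadicFract n x := by
    push_cast
    rw [← mul_add, dyadicIndex_add_fract]; ring
  rw [dyadicFract, h, Int.fract_intCast_add]

lemma floor_two_mul_dyadicFract (n : ℕ) (x : ℝ) :
    ⌊2 * dyadicFract n x⌋ = 0 ∨ ⌊2 * dyadicFract n x⌋ = 1 := by
  have h₀ := dyadicFract_nonneg n x
  have h₁ := dyadicFract_lt_one n x
  have h₂ : 0 ≤ ⌊2 * dyadicFract n x⌋ := Int.floor_nonneg.2 (by linarith)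
  have h₃ : ⌊2 * dyadicFract n x⌋ < 2 := Int.floor_lt.2 (by push_cast; linarith)
  omega

lemma dyadicIndex_eq_iff {n : ℕ} {x : ℝ} {k : ℤ} :
    dyadicIndex n x = k ↔ x ∈ Ico ((k : ℝ) / 2 ^ n) ((k + 1) / 2 ^ n) := by
  rw [dyadicIndex, Int.floor_eq_iff, mem_Ico, div_le_iff₀ (by positivity),
    lt_div_iff₀ (by positivity), mul_comm]

lemma dyadicIndex_eq_div_two (n : ℕ) (x : ℝ) :
    dyadicIndex n x = dyadicIndex (n + 1) x / 2 := by
  have h := dyadicIndex_succ n x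
  rcases floor_two_mul_dyadicFract n x with h' | h' <;> rw [h'] at h <;> omega

/-! ### Towers and the action they define -/

/-- The combinatorial data of a rank-one action of `ℤ^d` by cutting and stacking: at stage `n` the
levels of a tower of shape `latticeCube d (h n)` are the dyadic intervals of order `n` in
`[- m n / 2 ^ n, m n / 2 ^ n)`, labelled by `e n`, and every level is cut into halves that are moved
by `a n` and by `a n + t n` to levels of the next tower. -/
structure DyadicTowers (d : ℕ) where
  h : ℕ → ℕ
  m : ℕ → ℕ
  a : ℕ → Fin d → ℤ
  t : ℕ → Fin d → ℤ
  e : ℕ → ℤ → Fin d → ℤ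
  h_pos : ∀ n, 0 < h n
  two_mul_le : ∀ n, 2 * m n ≤ m (n + 1)
  exhaust : ∀ n, n * 2 ^ n ≤ m n
  bijOn : ∀ n, BijOn (e n) (Ico (-(m n : ℤ)) (m n)) (latticeCube d (h n))
  left_half : ∀ n, ∀ k ∈ Ico (-(m n : ℤ)) (m n), e (n + 1) (2 * k) = e n k + a n
  right_half : ∀ n, ∀ k ∈ Ico (-(m n : ℤ)) (m n), e (n + 1) (2 * k + 1) = e n k + (a n + t n)
  left_margin : ∀ n, ∀ f ∈ latticeCube d (h n), ∀ γ : Fin d → ℤ, (∀ i, |γ i| ≤ n) →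
    f + a n + γ ∈ latticeCube d (h (n + 1))
  right_margin : ∀ n, ∀ f ∈ latticeCube d (h n), ∀ γ : Fin d → ℤ, (∀ i, |γ i| ≤ n) →
    f + (a n + t n) + γ ∈ latticeCube d (h (n + 1))

namespace DyadicTowers

variable {d : ℕ} (R : DyadicTowers d)

/-- The indices of the levels of the tower of stage `n`. -/
def index (n : ℕ) : Set ℤ := Ico (-(R.m n : ℤ)) (R.m n)

/-- The point `x` lies in the tower of stage `n`. -/
def InTower (n : ℕ) (x : ℝ) : Prop := dyadicIndex n x ∈ R.index n

/-- The label of the level of stage `n` that contains `x`. -/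
noncomputable def pos (n : ℕ) (x : ℝ) : Fin d → ℤ := R.e n (dyadicIndex n x)

variable {R}

lemma InTower.succ {n : ℕ} {x : ℝ} (hx : R.InTower n x) : R.InTower (n + 1) x := by
  have h₁ := R.two_mul_le n
  have h₂ := dyadicIndex_succ n x
  simp only [InTower, index, mem_Ico] at hx ⊢
  rcases floor_two_mul_dyadicFract n x with h | h <;> omega

lemma InTower.mono {n k : ℕ} (hk : n ≤ k) {x : ℝ} (hx : R.InTower n x) : R.InTower k x := by
  induction k, hk using Nat.le_induction with
  | base => exact hx
  | succ k _ ih => exact ih.succ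

variable (R) in
lemma eventually_inTower (x : ℝ) : ∀ᶠ n in atTop, R.InTower n x := by
  obtain ⟨n, hn⟩ := exists_nat_gt |x|
  refine eventually_atTop.2 ⟨n, fun k hk => InTower.mono hk ?_⟩
  have h₁ : ((n : ℝ) * 2 ^ n) ≤ R.m n := by exact_mod_cast R.exhaust n
  have h₂ : (0 : ℝ) < 2 ^ n := by positivity
  obtain ⟨h₃, h₄⟩ := abs_lt.1 hn
  constructor
  · rw [dyadicIndex, Int.le_floor]; push_cast; nlinarith
  · rw [dyadicIndex, Int.floor_lt]; push_cast; nlinarith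

lemma InTower.pos_mem {n : ℕ} {x : ℝ} (hx : R.InTower n x) : R.pos n x ∈ latticeCube d (R.h n) :=
  (R.bijOn n).mapsTo hx

lemma InTower.pos_succ {n : ℕ} {x : ℝ} (hx : R.InTower n x) :
    R.pos (n + 1) x =
      R.pos n x + (R.a n + if ⌊2 * dyadicFract n x⌋ = 0 then 0 else R.t n) := by
  rw [pos, dyadicIndex_succ]
  rcases floor_two_mul_dyadicFract n x with h | h
  · rw [h, add_zero, R.left_half n _ hx]; simp [pos]
  · rw [h, R.right_half n _ hx]; simp [pos]

lemma InTower.pos_succ_add_mem {n : ℕ} {x : ℝ} (hx : R.InTower n x) {γ : Fin d → ℤ}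
    (hγ : ∀ i, |γ i| ≤ n) : R.pos (n + 1) x + γ ∈ latticeCube d (R.h (n + 1)) := by
  rw [hx.pos_succ]
  split_ifs
  · simpa using R.left_margin n _ hx.pos_mem γ hγ
  · exact R.right_margin n _ hx.pos_mem γ hγ

variable (R) in
lemma eventually_pos_add_mem (x : ℝ) (γ : Fin d → ℤ) :
    ∀ᶠ n in atTop, R.pos n x + γ ∈ latticeCube d (R.h n) := by
  -- The margins of stage `n` sit inside the cube of stage `n + 1`, hence the shift of the index.
  rw [← Filter.map_add_atTop_eq_nat 1, eventually_map]
  have h : ∀ᶠ n : ℕ in atTop, ∀ i, |γ i| ≤ n := by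
    rw [eventually_all]
    intro i
    obtain ⟨k, hk⟩ := exists_nat_ge |γ i|
    exact eventually_atTop.2 ⟨k, fun n hn => hk.trans (by exact_mod_cast hn)⟩
  filter_upwards [h, R.eventually_inTower x] with n hn hx using hx.pos_succ_add_mem hn

variable (R) in
/-- The points `x` and `y` lie in the tower of stage `n`, at the same relative position in levels
whose labels differ by `γ`. -/
def RelAt (γ : Fin d → ℤ) (n : ℕ) (x y : ℝ) : Prop :=
  R.InTower n x ∧ R.InTower n y ∧ R.pos n y = R.pos n x + γ ∧ dyadicFract n y = dyadicFract n x

/-- Equal relative positions put `x` and `y` in the same half of their levels, so both labels move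
by the same vector. This makes the translations of successive stages compatible. -/
lemma RelAt.succ {γ : Fin d → ℤ} {n : ℕ} {x y : ℝ} (h : R.RelAt γ n x y) :
    R.RelAt γ (n + 1) x y := by
  obtain ⟨hx, hy, h₁, h₂⟩ := h
  refine ⟨hx.succ, hy.succ, ?_, ?_⟩
  · rw [hx.pos_succ, hy.pos_succ, h₁, h₂]; abel
  · rw [dyadicFract_succ, dyadicFract_succ, h₂]

lemma RelAt.mono {γ : Fin d → ℤ} {n k : ℕ} (hk : n ≤ k) {x y : ℝ} (h : R.RelAt γ n x y) :
    R.RelAt γ k x y := by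
  induction k, hk using Nat.le_induction with
  | base => exact h
  | succ k _ ih => exact ih.succ

lemma RelAt.unique {γ : Fin d → ℤ} {n : ℕ} {x y z : ℝ} (hy : R.RelAt γ n x y)
    (hz : R.RelAt γ n x z) : y = z := by
  obtain ⟨-, hy₀, hy₁, hy₂⟩ := hy
  obtain ⟨-, hz₀, hz₁, hz₂⟩ := hz
  exact eq_of_dyadic_eq ((R.bijOn n).injOn hy₀ hz₀ (hy₁.trans hz₁.symm)) (hy₂.trans hz₂.symm)

variable (R) in
/-- The approximation of the translation by `γ` by means of the tower of stage `n`. -/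
noncomputable def stageMap (γ : Fin d → ℤ) (n : ℕ) (x : ℝ) : ℝ :=
  (Function.invFunOn (R.e n) (R.index n) (R.pos n x + γ) + dyadicFract n x) / 2 ^ n

lemma relAt_stageMap {γ : Fin d → ℤ} {n : ℕ} {x : ℝ} (hx : R.InTower n x)
    (hγ : R.pos n x + γ ∈ latticeCube d (R.h n)) : R.RelAt γ n x (R.stageMap γ n x) := by
  have h := (R.bijOn n).surjOn hγ
  have h₁ := dyadicIndex_div (n := n) (Function.invFunOn (R.e n) (R.index n) (R.pos n x + γ))
    (dyadicFract_nonneg n x) (dyadicFract_lt_one n x)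
  have h₂ := dyadicFract_div (n := n) (Function.invFunOn (R.e n) (R.index n) (R.pos n x + γ))
    (dyadicFract_nonneg n x) (dyadicFract_lt_one n x)
  refine ⟨hx, ?_, ?_, h₂⟩
  · rw [InTower, stageMap, h₁]; exact Function.invFunOn_mem h
  · rw [pos, stageMap, h₁]; exact Function.invFunOn_eq h

variable (R) in
lemma exists_relAt (γ : Fin d → ℤ) (x : ℝ) : ∃ y, ∃ n, R.RelAt γ n x y := by
  obtain ⟨n, hn, hx⟩ := ((R.eventually_pos_add_mem x γ).and (R.eventually_inTower x)).exists
  exact ⟨_, n, relAt_stageMap hx hn⟩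

variable (R) in
/-- The transformation `T γ` of the action. -/
noncomputable def act (γ : Fin d → ℤ) (x : ℝ) : ℝ := (R.exists_relAt γ x).choose

lemma RelAt.act_eq {γ : Fin d → ℤ} {n : ℕ} {x y : ℝ} (h : R.RelAt γ n x y) : R.act γ x = y := by
  obtain ⟨k, hk⟩ := (R.exists_relAt γ x).choose_spec
  exact RelAt.unique (hk.mono (le_max_left k n)) (h.mono (le_max_right k n))

variable (R) in
lemma eventually_relAt_act (γ : Fin d → ℤ) (x : ℝ) : ∀ᶠ n in atTop, R.RelAt γ n x (R.act γ x) := by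
  obtain ⟨k, hk⟩ := (R.exists_relAt γ x).choose_spec
  exact eventually_atTop.2 ⟨k, fun n hn => hk.mono hn⟩

lemma act_zero (x : ℝ) : R.act 0 x = x := by
  obtain ⟨n, hn⟩ := (R.eventually_inTower x).exists
  exact RelAt.act_eq (n := n) ⟨hn, hn, by simp, rfl⟩

lemma act_add (γ γ' : Fin d → ℤ) (x : ℝ) : R.act (γ + γ') x = R.act γ (R.act γ' x) := by
  obtain ⟨n, ⟨h₀, -, h₁, h₂⟩, ⟨-, h₃, h₄, h₅⟩⟩ :=
    ((R.eventually_relAt_act γ' x).and (R.eventually_relAt_act γ (R.act γ' x))).exists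
  exact RelAt.act_eq (n := n) ⟨h₀, h₃, by rw [h₄, h₁]; abel, h₅.trans h₂⟩

lemma act_ne {γ : Fin d → ℤ} (hγ : γ ≠ 0) (x : ℝ) : R.act γ x ≠ x := by
  intro h
  obtain ⟨n, -, -, h₁, -⟩ := (R.eventually_relAt_act γ x).exists
  rw [h] at h₁
  exact hγ (by simpa using h₁.symm)

lemma measurable_pos (n : ℕ) : Measurable (R.pos n) :=
  measurable_from_top.comp (measurable_dyadicIndex n)

lemma measurable_stageMap (γ : Fin d → ℤ) (n : ℕ) : Measurable (R.stageMap γ n) := by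
  have h : Measurable fun k : ℤ =>
      ((Function.invFunOn (R.e n) (R.index n) (R.e n k + γ) : ℤ) : ℝ) := measurable_from_top
  exact ((h.comp (measurable_dyadicIndex n)).add (measurable_dyadicFract n)).div_const _

/-- At each point the stage maps are eventually equal to the action, so it is their pointwise limit.
-/
lemma measurable_act (γ : Fin d → ℤ) : Measurable (R.act γ) := by
  refine measurable_of_tendsto_metrizable (measurable_stageMap (R := R) γ)
    (tendsto_pi_nhds.2 fun x => tendsto_const_nhds.congr' ?_)
  filter_upwards [R.eventually_pos_add_mem x γ, R.eventually_inTower x] with n hn hx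
    using (relAt_stageMap hx hn).act_eq

lemma exists_act_eq_add_rat (γ : Fin d → ℤ) (x : ℝ) : ∃ q : ℚ, R.act γ x = x + q := by
  obtain ⟨n, -, -, -, h⟩ := (R.eventually_relAt_act γ x).exists
  refine ⟨(dyadicIndex n (R.act γ x) - dyadicIndex n x) / 2 ^ n, ?_⟩
  have h₁ := dyadicIndex_add_fract n (R.act γ x)
  have h₂ := dyadicIndex_add_fract n x
  push_cast
  field_simp
  linarith

end DyadicTowers

/-! ### Invariance of Lebesgue measure -/

/-- The line splits into countably many pieces on which `T` is a translation; invertibility keeps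
their images disjoint. -/
lemma measurePreserving_of_countable_translations {T U : ℝ → ℝ} (hT : Measurable T)
    (hU : Measurable U) (hUT : ∀ x, U (T x) = x) (hTU : ∀ x, T (U x) = x)
    (hq : ∀ x, ∃ q : ℚ, T x = x + q) : MeasurePreserving T volume volume := by
  refine ⟨hT, Measure.ext fun A hA => ?_⟩
  rw [Measure.map_apply hT hA]
  let P : ℚ → Set ℝ := fun q => {x | T x = x + q}
  have hP : ∀ q, MeasurableSet (P q) := fun q => measurableSet_eq_fun hT (by fun_prop)
  have hdisj : Pairwise fun q r => Disjoint (P q) (P r) := by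
    refine fun q r hqr => disjoint_left.2 fun x hx hx' => hqr ?_
    have : (q : ℝ) = r := add_left_cancel (hx.symm.trans hx')
    exact_mod_cast this
  have h₁ : T ⁻¹' A = ⋃ q, T ⁻¹' A ∩ P q := by
    rw [← inter_iUnion, eq_comm, inter_eq_left]
    exact fun x _ => mem_iUnion.2 (hq x)
  have h₂ : A = ⋃ q, A ∩ U ⁻¹' P q := by
    rw [← inter_iUnion, eq_comm, inter_eq_left]
    exact fun x _ => mem_iUnion.2 (hq (U x))
  rw [h₁]
  conv_rhs => rw [h₂]
  rw [measure_iUnion (fun q r hqr => (hdisj hqr).mono inter_subset_right inter_subset_right)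
      fun q => (hT hA).inter (hP q),
    measure_iUnion (fun q r hqr => ((hdisj hqr).preimage U).mono inter_subset_right
      inter_subset_right) fun q => hA.inter (hU (hP q))]
  refine tsum_congr fun q => ?_
  rw [← measure_preimage_add_right volume (q : ℝ) (A ∩ U ⁻¹' P q)]
  congr 1
  ext x
  simp only [mem_inter_iff, mem_preimage, P, mem_ofPred_eq]
  constructor
  · rintro ⟨h, h'⟩
    have h'' : U (x + q) = x := by rw [← h', hUT]
    exact ⟨h' ▸ h, by rw [h'', h']⟩
  · rintro ⟨h, h'⟩
    have h'' : U (x + q) = x := by rw [hTU] at h'; linarith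
    rw [h''] at h'
    exact ⟨h' ▸ h, h'⟩

namespace DyadicTowers

variable {d : ℕ} (R : DyadicTowers d)

lemma measurePreserving_act (γ : Fin d → ℤ) : MeasurePreserving (R.act γ) volume volume :=
  measurePreserving_of_countable_translations (measurable_act γ) (measurable_act (-γ))
    (fun x => by rw [← act_add, neg_add_cancel, act_zero])
    (fun x => by rw [← act_add, add_neg_cancel, act_zero]) (exists_act_eq_add_rat γ)

/-- The action of `ℤ^d` on the real line defined by a sequence of towers. -/
noncomputable def action : InfiniteMPAction d where
  X := ℝ
  μ := volume
  measure_univ := Real.volume_univ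
  T := R.act
  map_zero := act_zero
  map_add := act_add
  measurePreserving := R.measurePreserving_act

lemma isFree_action : R.action.IsFree := fun _ hγ x => act_ne hγ x

/-! ### Levels of the towers -/

/-- The level of stage `n` with label `f`. -/
def level (n : ℕ) (f : Fin d → ℤ) : Set ℝ := {x | R.InTower n x ∧ R.pos n x = f}

variable {R}

lemma measurableSet_level (n : ℕ) (f : Fin d → ℤ) : MeasurableSet (R.level n f) :=
  (measurable_dyadicIndex n (MeasurableSet.of_discrete (s := R.index n))).inter
    (measurable_pos n (measurableSet_singleton f))

lemma level_eq_Ico {n : ℕ} {k : ℤ} (hk : k ∈ R.index n) :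
    R.level n (R.e n k) = Ico ((k : ℝ) / 2 ^ n) ((k + 1) / 2 ^ n) := by
  ext x
  rw [← dyadicIndex_eq_iff]
  exact ⟨fun h => (R.bijOn n).injOn h.1 hk h.2, fun h => ⟨by rwa [InTower, h], by rw [pos, h]⟩⟩

lemma volume_Ico_dyadic (n : ℕ) (k : ℤ) :
    volume (Ico ((k : ℝ) / 2 ^ n) ((k + 1) / 2 ^ n)) = ENNReal.ofReal (1 / 2 ^ n) := by
  rw [Real.volume_Ico]; congr 1; ring

lemma volume_level {n : ℕ} {f : Fin d → ℤ} (hf : f ∈ latticeCube d (R.h n)) :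
    volume (R.level n f) = ENNReal.ofReal (1 / 2 ^ n) := by
  obtain ⟨k, hk, rfl⟩ := (R.bijOn n).surjOn hf
  rw [level_eq_Ico hk, volume_Ico_dyadic]

lemma image_act_level {n : ℕ} {f γ : Fin d → ℤ} (hf : f ∈ latticeCube d (R.h n))
    (hfγ : f + γ ∈ latticeCube d (R.h n)) : R.act γ '' R.level n f = R.level n (f + γ) := by
  have key : ∀ f γ : Fin d → ℤ, f + γ ∈ latticeCube d (R.h n) → ∀ x ∈ R.level n f,
      R.act γ x ∈ R.level n (f + γ) := by
    rintro f γ hfγ x ⟨hx, rfl⟩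
    have h := relAt_stageMap hx hfγ
    rw [h.act_eq]
    exact ⟨h.2.1, h.2.2.1⟩
  refine Subset.antisymm (image_subset_iff.2 fun x hx => key f γ hfγ x hx) fun y hy =>
    ⟨R.act (-γ) y, ?_, ?_⟩
  · simpa using key (f + γ) (-γ) (by simpa using hf) y hy
  · rw [← act_add, add_neg_cancel, act_zero]

lemma image_act_level_zero {n : ℕ} {f : Fin d → ℤ} (hf : f ∈ latticeCube d (R.h n)) :
    R.act f '' R.level n 0 = R.level n f := by
  have h₀ : (0 : Fin d → ℤ) ∈ latticeCube d (R.h n) :=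
    fun i => ⟨le_rfl, by simpa using R.h_pos n⟩
  simpa using image_act_level h₀ (γ := f) (by simpa using hf)

lemma add_a_mem {n : ℕ} {f : Fin d → ℤ} (hf : f ∈ latticeCube d (R.h n)) :
    f + R.a n ∈ latticeCube d (R.h (n + 1)) := by
  simpa using R.left_margin n f hf 0 (by simp)

lemma add_a_add_t_mem {n : ℕ} {f : Fin d → ℤ} (hf : f ∈ latticeCube d (R.h n)) :
    f + (R.a n + R.t n) ∈ latticeCube d (R.h (n + 1)) := by
  simpa using R.right_margin n f hf 0 (by simp)

lemma two_mul_mem_index {n : ℕ} {k : ℤ} (hk : k ∈ R.index n) : 2 * k ∈ R.index (n + 1) := by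
  have := R.two_mul_le n
  simp only [index, mem_Ico] at hk ⊢
  omega

lemma two_mul_add_one_mem_index {n : ℕ} {k : ℤ} (hk : k ∈ R.index n) :
    2 * k + 1 ∈ R.index (n + 1) := by
  have := R.two_mul_le n
  simp only [index, mem_Ico] at hk ⊢
  omega

lemma level_eq_union {n : ℕ} {f : Fin d → ℤ} (hf : f ∈ latticeCube d (R.h n)) :
    R.level n f = R.level (n + 1) (f + R.a n) ∪ R.level (n + 1) (f + (R.a n + R.t n)) := by
  obtain ⟨k, hk, rfl⟩ := (R.bijOn n).surjOn hf
  rw [← R.left_half n k hk, ← R.right_half n k hk, level_eq_Ico hk,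
    level_eq_Ico (two_mul_mem_index hk), level_eq_Ico (two_mul_add_one_mem_index hk)]
  ext x
  simp only [mem_union, ← dyadicIndex_eq_iff]
  have := dyadicIndex_eq_div_two n x
  omega

end DyadicTowers

/-! ### Return times -/

/-- Lebesgue's density theorem along dyadic intervals, in the form of a weak lower bound. -/
lemma exists_eventually_half_lt_volume_inter_dyadic {A : Set ℝ} (hA : 0 < volume A) :
    ∃ x : ℝ, ∀ᶠ n : ℕ in atTop, ENNReal.ofReal (1 / 2 ^ (n + 1)) <
      volume (A ∩ Ico ((dyadicIndex n x : ℝ) / 2 ^ n) ((dyadicIndex n x + 1) / 2 ^ n)) := by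
  have : NeBot (ae (volume.restrict A)) := by
    rw [ae_neBot, Ne, Measure.restrict_eq_zero]; exact hA.ne'
  obtain ⟨x, hx⟩ := (IsUnifLocDoublingMeasure.ae_tendsto_measure_inter_div volume A 1).exists
  refine ⟨x, ?_⟩
  have hball : ∀ n : ℕ, Metric.closedBall (((dyadicIndex n x : ℝ) + 1 / 2) / 2 ^ n)
      (1 / 2 ^ (n + 1)) = Icc ((dyadicIndex n x : ℝ) / 2 ^ n) ((dyadicIndex n x + 1) / 2 ^ n) := by
    intro n
    rw [Real.closedBall_eq_Icc, pow_succ]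
    congr 1 <;> field_simp <;> ring
  have hδ : Tendsto (fun n : ℕ => (1 : ℝ) / 2 ^ (n + 1)) atTop (nhdsWithin 0 (Ioi 0)) := by
    refine tendsto_nhdsWithin_iff.2 ⟨?_, .of_forall fun n => mem_Ioi.2 (by positivity)⟩
    have h := (tendsto_pow_atTop_nhds_zero_of_lt_one (r := (1 / 2 : ℝ)) (by norm_num)
      (by norm_num)).comp (tendsto_add_atTop_nat 1)
    exact h.congr fun n => by simp
  -- The balls are centred at midpoints of dyadic intervals, not at `x`; the density theorem used
  -- only requires that they contain `x`.
  have hlim := hx (fun n : ℕ => ((dyadicIndex n x : ℝ) + 1 / 2) / 2 ^ n) _ hδ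
    (.of_forall fun n => by
      rw [one_mul, hball]; exact Ico_subset_Icc_self (dyadicIndex_eq_iff.1 rfl))
  have hhalf : (2⁻¹ : ℝ≥0∞) < 1 := by norm_num
  filter_upwards [hlim.eventually_const_lt hhalf] with n hn
  rw [hball, measure_congr (Ico_ae_eq_Icc (μ := volume)).symm,
    measure_congr ((ae_eq_refl A).inter (Ico_ae_eq_Icc (μ := volume)).symm),
    DyadicTowers.volume_Ico_dyadic] at hn
  have hn' := ENNReal.mul_lt_of_lt_div hn
  refine lt_of_eq_of_lt ?_ hn'
  rw [pow_succ, one_div, mul_inv, mul_comm, ENNReal.ofReal_mul (by norm_num),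
    ENNReal.ofReal_inv_of_pos (by norm_num), one_div]
  simp

namespace DyadicTowers

variable {d : ℕ} (R : DyadicTowers d)

lemma act_t_eq_add {n : ℕ} {k : ℤ} (hk : k ∈ R.index n) {x : ℝ}
    (hx : dyadicIndex (n + 1) x = 2 * k) :
    R.act (R.t n) x = x + 1 / 2 ^ (n + 1) ∧
      dyadicIndex (n + 1) (x + 1 / 2 ^ (n + 1)) = 2 * k + 1 := by
  have h : (2 : ℝ) ^ (n + 1) * (x + 1 / 2 ^ (n + 1)) = 2 ^ (n + 1) * x + 1 := by field_simp
  have hi : dyadicIndex (n + 1) (x + 1 / 2 ^ (n + 1)) = 2 * k + 1 := by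
    rw [← hx, dyadicIndex, h, Int.floor_add_one, dyadicIndex]
  refine ⟨RelAt.act_eq (n := n + 1) ⟨?_, ?_, ?_, ?_⟩, hi⟩
  · rw [InTower, hx]; exact two_mul_mem_index hk
  · rw [InTower, hi]; exact two_mul_add_one_mem_index hk
  · rw [pos, pos, hi, hx, R.left_half n k hk, R.right_half n k hk, add_assoc]
  · rw [dyadicFract, h, Int.fract_add_one, dyadicFract]

/-- The part of `A` in the left half, shifted by `t n`, and the part in the right half both lie in
the right half. Their measures add up to more than its length, so they overlap in positive measure.
-/
lemma volume_inter_image_act_t_pos {n : ℕ} {k : ℤ} (hk : k ∈ R.index n) {A : Set ℝ}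
    (hA : MeasurableSet A) (h : ENNReal.ofReal (1 / 2 ^ (n + 1)) <
      volume (A ∩ Ico ((k : ℝ) / 2 ^ n) ((k + 1) / 2 ^ n))) :
    0 < volume (A ∩ R.act (R.t n) '' A) := by
  set L : ℤ → Set ℝ := fun j => {x | dyadicIndex (n + 1) x = j} with hL
  have hLm : ∀ j, MeasurableSet (L j) := fun j =>
    measurable_dyadicIndex (n + 1) (measurableSet_singleton j)
  have hsplit : A ∩ Ico ((k : ℝ) / 2 ^ n) ((k + 1) / 2 ^ n) ⊆
      (A ∩ L (2 * k)) ∪ (A ∩ L (2 * k + 1)) := by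
    rintro x ⟨hxA, hx⟩
    rw [← dyadicIndex_eq_iff] at hx
    have h₁ := dyadicIndex_eq_div_two n x
    rcases (by omega : dyadicIndex (n + 1) x = 2 * k ∨ dyadicIndex (n + 1) x = 2 * k + 1)
      with h₂ | h₂
    · exact Or.inl ⟨hxA, h₂⟩
    · exact Or.inr ⟨hxA, h₂⟩
  set B : Set ℝ := (fun y => y + -(1 / 2 ^ (n + 1) : ℝ)) ⁻¹' (A ∩ L (2 * k)) with hB
  have hBm : volume B = volume (A ∩ L (2 * k)) := measure_preimage_add_right _ _ _
  have hBprop : ∀ y ∈ B, y ∈ L (2 * k + 1) ∧ y ∈ R.act (R.t n) '' A := by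
    rintro y ⟨hyA, hyL⟩
    obtain ⟨h₁, h₂⟩ := R.act_t_eq_add hk hyL
    rw [neg_add_cancel_right] at h₁ h₂
    exact ⟨h₂, _, hyA, h₁⟩
  have hBC : B ∪ (A ∩ L (2 * k + 1)) ⊆ L (2 * k + 1) :=
    union_subset (fun y hy => (hBprop y hy).1) inter_subset_right
  have hL1 : volume (L (2 * k + 1)) = ENNReal.ofReal (1 / 2 ^ (n + 1)) := by
    rw [← volume_Ico_dyadic (n + 1) (2 * k + 1)]
    congr 1
    ext x
    exact dyadicIndex_eq_iff
  refine pos_of_ne_zero fun h₀ => ?_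
  have hzero : volume (B ∩ (A ∩ L (2 * k + 1))) = 0 :=
    measure_mono_null (t := A ∩ R.act (R.t n) '' A) (fun y hy => ⟨hy.2.1, (hBprop y hy.1).2⟩) h₀
  have hadd := measure_union_add_inter (μ := volume) B (hA.inter (hLm (2 * k + 1)))
  rw [hzero, add_zero, hBm] at hadd
  have hle := calc
    volume (A ∩ Ico ((k : ℝ) / 2 ^ n) ((k + 1) / 2 ^ n))
      ≤ volume (A ∩ L (2 * k)) + volume (A ∩ L (2 * k + 1)) :=
        (measure_mono hsplit).trans (measure_union_le _ _)
    _ = volume (B ∪ (A ∩ L (2 * k + 1))) := hadd.symm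
    _ ≤ ENNReal.ofReal (1 / 2 ^ (n + 1)) := hL1 ▸ measure_mono hBC
  exact absurd h hle.not_gt

/-- Every set of positive measure returns to itself under `T (t n)`, for all large `n`. -/
lemma eventually_volume_inter_image_act_t_pos {A : Set ℝ} (hA : MeasurableSet A)
    (hA' : 0 < volume A) : ∀ᶠ n in atTop, 0 < volume (A ∩ R.act (R.t n) '' A) := by
  obtain ⟨x, hx⟩ := exists_eventually_half_lt_volume_inter_dyadic hA'
  filter_upwards [hx, R.eventually_inTower x] with n hn hx'
    using R.volume_inter_image_act_t_pos hx' hA hn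

/-- A nonzero return time to the base of stage `n` is `± t k` for some `k ≥ n`, up to a difference
of two elements of the cube of stage `k`. -/
lemma exists_eq_t_add_of_level_inter_nonempty {n : ℕ} {γ : Fin d → ℤ} (hγ : γ ≠ 0)
    {f : Fin d → ℤ} (h : (R.level n f ∩ R.act γ '' R.level n f).Nonempty) :
    ∃ k ≥ n, ∃ p ∈ latticeCube d (R.h k), ∃ q ∈ latticeCube d (R.h k),
      γ = q - p + R.t k ∨ γ = q - p - R.t k := by
  classical
  obtain ⟨-, ⟨hy, hyf⟩, x, ⟨hx, hxf⟩, rfl⟩ := h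
  set y := R.act γ x
  -- Take the first stage at which the labels differ by `γ`. It is not `n`, where both labels are
  -- `f`; one stage earlier the points must lie in opposite halves of their levels.
  have hex : ∃ k, n ≤ k ∧ R.pos k y = R.pos k x + γ := by
    obtain ⟨k, hk, hk'⟩ := ((R.eventually_relAt_act γ x).and (eventually_ge_atTop n)).exists
    exact ⟨k, hk', hk.2.2.1⟩
  obtain ⟨hk, hk'⟩ := Nat.find_spec hex
  have hmin := fun j => Nat.find_min hex (m := j)
  generalize Nat.find hex = k at hk hk' hmin
  have hnk : n ≠ k := by
    rintro rfl
    rw [hxf, hyf] at hk'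
    exact hγ (by simpa using hk'.symm)
  obtain ⟨j, rfl⟩ : ∃ j, k = j + 1 := ⟨k - 1, by omega⟩
  have hxj := hx.mono (show n ≤ j by omega)
  have hyj := hy.mono (show n ≤ j by omega)
  have hne : R.pos j y ≠ R.pos j x + γ := fun h => hmin j (by omega) ⟨by omega, h⟩
  refine ⟨j, by omega, _, hxj.pos_mem, _, hyj.pos_mem, ?_⟩
  rw [hxj.pos_succ, hyj.pos_succ] at hk'
  split_ifs at hk' with h₁ h₂ h₂
  · exact absurd (by simpa [add_right_comm] using hk') hne
  · right; linear_combination -hk'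
  · left; linear_combination -hk'
  · refine absurd ?_ hne
    linear_combination hk'

/-! ### Generation by levels and rank one -/

/-- The labels of the levels of stage `n` contained in `U`. -/
def levelsIn (U : Set ℝ) (n : ℕ) : Set (Fin d → ℤ) :=
  {f | f ∈ latticeCube d (R.h n) ∧ R.level n f ⊆ U}

lemma monotone_iUnion_levelsIn (U : Set ℝ) :
    Monotone fun n => ⋃ f ∈ R.levelsIn U n, R.level n f := by
  refine monotone_nat_of_le_succ fun n x hx => ?_
  obtain ⟨f, ⟨hf, hfU⟩, hx⟩ := mem_iUnion₂.1 hx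
  rw [level_eq_union hf] at hx hfU
  rcases hx with hx | hx
  · exact mem_iUnion₂.2 ⟨_, ⟨add_a_mem hf, subset_union_left.trans hfU⟩, hx⟩
  · exact mem_iUnion₂.2 ⟨_, ⟨add_a_add_t_mem hf, subset_union_right.trans hfU⟩, hx⟩

lemma iUnion_levelsIn {U : Set ℝ} (hU : IsOpen U) :
    ⋃ n, ⋃ f ∈ R.levelsIn U n, R.level n f = U := by
  refine Subset.antisymm (iUnion_subset fun n => iUnion₂_subset fun f hf => hf.2) fun x hx => ?_
  obtain ⟨ε, hε, hball⟩ := Metric.isOpen_iff.1 hU x hx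
  have hlim : Tendsto (fun n : ℕ => (1 / 2 : ℝ) ^ n) atTop (nhds 0) :=
    tendsto_pow_atTop_nhds_zero_of_lt_one (by norm_num) (by norm_num)
  obtain ⟨n, hxn, hn⟩ := ((R.eventually_inTower x).and (hlim.eventually_lt_const hε)).exists
  refine mem_iUnion.2 ⟨n, mem_iUnion₂.2 ⟨_, ⟨hxn.pos_mem, fun y hy => hball ?_⟩, hxn, rfl⟩⟩
  rw [pos, level_eq_Ico hxn] at hy
  have hx' := (dyadicIndex_eq_iff (n := n)).1 (rfl : dyadicIndex n x = _)
  rw [Metric.mem_ball, Real.dist_eq]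
  rw [one_div, inv_pow] at hn
  rw [mem_Ico, add_div, one_div] at hy hx'
  exact abs_sub_lt_iff.2 ⟨by linarith [hy.2, hx'.1], by linarith [hy.1, hx'.2]⟩

/-- Outer regularity replaces `A` by an open set, which is the increasing union over the stages of
the levels it contains. -/
lemma exists_levels_approx {A : Set ℝ} (hA : MeasurableSet A) (hA' : volume A < ∞) {ε : ℝ≥0∞}
    (hε : 0 < ε) : ∀ᶠ n in atTop, ∃ S ⊆ latticeCube d (R.h n),
      volume (A ∆ ⋃ f ∈ S, R.level n f) < ε := by
  have hε2 : ε / 2 ≠ 0 := (ENNReal.half_pos hε.ne').ne'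
  obtain ⟨U, hAU, hU, hUfin, hUA⟩ := hA.exists_isOpen_sdiff_lt hA'.ne hε2
  have hmeas : ∀ n, MeasurableSet (⋃ f ∈ R.levelsIn U n, R.level n f) := fun n =>
    MeasurableSet.biUnion (to_countable _) fun f _ => measurableSet_level n f
  have hlim : Tendsto (volume ∘ fun n => U \ ⋃ f ∈ R.levelsIn U n, R.level n f) atTop
      (nhds (volume (⋂ n, U \ ⋃ f ∈ R.levelsIn U n, R.level n f))) :=
    tendsto_measure_iInter_atTop (fun n => (hU.measurableSet.diff (hmeas n)).nullMeasurableSet)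
      (fun i j hij => sdiff_le_sdiff_left (R.monotone_iUnion_levelsIn U hij))
      ⟨0, ((measure_mono sdiff_subset).trans_lt hUfin).ne⟩
  rw [← sdiff_iUnion, R.iUnion_levelsIn hU, sdiff_self, measure_empty] at hlim
  filter_upwards [hlim.eventually_lt_const (pos_of_ne_zero hε2)] with n hn
  refine ⟨R.levelsIn U n, fun f hf => hf.1, ?_⟩
  have hsub : (⋃ f ∈ R.levelsIn U n, R.level n f) ⊆ U := iUnion₂_subset fun f hf => hf.2
  calc volume (A ∆ ⋃ f ∈ R.levelsIn U n, R.level n f)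
      ≤ volume ((U \ ⋃ f ∈ R.levelsIn U n, R.level n f) ∪ (U \ A)) := by
        refine measure_mono ?_
        rintro x (⟨h₁, h₂⟩ | ⟨h₁, h₂⟩)
        · exact Or.inl ⟨hAU h₁, h₂⟩
        · exact Or.inr ⟨hsub h₁, h₂⟩
    _ ≤ _ := measure_union_le _ _
    _ < ε / 2 + ε / 2 := ENNReal.add_lt_add hn hUA
    _ = ε := ENNReal.add_halves ε

lemma isRankOne_action : R.action.IsRankOne := by
  have h₀ : ∀ n, (0 : Fin d → ℤ) ∈ latticeCube d (R.h n) :=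
    fun n i => ⟨le_rfl, by simpa using R.h_pos n⟩
  refine ⟨R.h, fun n => R.level n 0, fun n => ⟨R.h_pos n, measurableSet_level n 0, ?_, ?_⟩,
    fun n f hf g hg hfg => ?_, fun n => ⟨{R.a n, R.a n + R.t n}, ?_, ?_⟩, ?_⟩
  · refine lt_of_lt_of_eq ?_ (volume_level (h₀ n)).symm
    exact ENNReal.ofReal_pos.2 (by positivity)
  · exact lt_of_eq_of_lt (volume_level (h₀ n)) ENNReal.ofReal_lt_top
  · change Disjoint (R.act f '' R.level n 0) (R.act g '' R.level n 0)
    rw [image_act_level_zero hf, image_act_level_zero hg]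
    exact disjoint_left.2 fun x hx hx' => hfg (hx.2.symm.trans hx'.2)
  · rintro f hf c (rfl | rfl)
    exacts [add_a_mem hf, add_a_add_t_mem hf]
  · change R.level n 0 = ⋃ c ∈ _, R.act c '' R.level (n + 1) 0
    rw [biUnion_pair, image_act_level_zero (by simpa using add_a_mem (h₀ n)),
      image_act_level_zero (by simpa using add_a_add_t_mem (h₀ n)), level_eq_union (h₀ n),
      zero_add, zero_add]
  · intro A hA hA' ε hε
    filter_upwards [R.exists_levels_approx hA hA' hε] with n ⟨S, hS, h⟩
    refine ⟨S, hS, ?_⟩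
    have : ⋃ f ∈ S, R.action.T f '' R.level n 0 = ⋃ f ∈ S, R.level n f :=
      iUnion₂_congr fun f hf => image_act_level_zero (hS hf)
    rw [this]
    exact h

end DyadicTowers

/-! ### Existence of towers with prescribed shifts -/

lemma latticeCube_eq_coe_piFinset (d h : ℕ) :
    latticeCube d h = (Fintype.piFinset fun _ : Fin d => Finset.Ico (0 : ℤ) h : Finset _) := by
  ext f
  simp [latticeCube]

/-- Both sets have `h ^ d` elements, so a partial injection extends to a bijection. The new values
label the spacers, whose arrangement is immaterial. -/
lemma exists_bijOn_Ico_latticeCube_extending {d m h : ℕ} (hm : 2 * m = h ^ d) {s : Set ℤ}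
    {f : ℤ → Fin d → ℤ} (hs : s ⊆ Ico (-(m : ℤ)) m) (hf : MapsTo f s (latticeCube d h))
    (hf' : InjOn f s) :
    ∃ e : ℤ → Fin d → ℤ, BijOn e (Ico (-(m : ℤ)) m) (latticeCube d h) ∧ EqOn e f s := by
  classical
  have hcard : Fintype.card (Finset.Ico (-(m : ℤ)) m) =
      (Fintype.piFinset fun _ : Fin d => Finset.Ico (0 : ℤ) h).card := by
    simp [← hm]; omega
  obtain ⟨g, hg⟩ := MapsTo.exists_equiv_extend_of_card_eq hcard
    (s := Subtype.val ⁻¹' s) (f := fun k => f k)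
    (fun k hk => by rw [← latticeCube_eq_coe_piFinset]; exact hf hk)
    (fun k hk l hl hkl => Subtype.ext (hf' hk hl hkl))
  refine ⟨fun k => if hk : k ∈ Finset.Ico (-(m : ℤ)) m then g ⟨k, hk⟩ else 0,
    ⟨fun k hk => ?_, fun k hk l hl hkl => ?_, fun x hx => ?_⟩, fun k hk => ?_⟩
  · rw [← Finset.coe_Ico, Finset.mem_coe] at hk
    simp only [dif_pos hk, latticeCube_eq_coe_piFinset]
    exact (g ⟨k, hk⟩).2
  · rw [← Finset.coe_Ico, Finset.mem_coe] at hk hl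
    simp only [dif_pos hk, dif_pos hl] at hkl
    exact congrArg Subtype.val (g.injective (Subtype.ext hkl))
  · rw [latticeCube_eq_coe_piFinset, Finset.mem_coe] at hx
    refine ⟨g.symm ⟨x, hx⟩, ?_, ?_⟩
    · rw [← Finset.coe_Ico]; exact (g.symm ⟨x, hx⟩).2
    · simp only [dif_pos (g.symm ⟨x, hx⟩).2, Subtype.coe_eta, Equiv.apply_symm_apply]
  · have hk' : k ∈ Finset.Ico (-(m : ℤ)) m := by
      rw [← Finset.mem_coe, Finset.coe_Ico]; exact hs hk
    simp only [dif_pos hk']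
    exact hg ⟨k, hk'⟩ hk

/-- The labelling of a tower extends to the next tower. -/
lemma exists_next_labelling {d m h m' h' : ℕ} {a t : Fin d → ℤ} {e : ℤ → Fin d → ℤ}
    (he : BijOn e (Ico (-(m : ℤ)) m) (latticeCube d h)) (hm : 2 * m ≤ m') (hm' : 2 * m' = h' ^ d)
    (ht : ∀ f ∈ latticeCube d h, f + t ∉ latticeCube d h)
    (ha : ∀ f ∈ latticeCube d h, f + a ∈ latticeCube d h')
    (hat : ∀ f ∈ latticeCube d h, f + (a + t) ∈ latticeCube d h') :
    ∃ e' : ℤ → Fin d → ℤ, BijOn e' (Ico (-(m' : ℤ)) m') (latticeCube d h') ∧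
      ∀ k ∈ Ico (-(m : ℤ)) m, e' (2 * k) = e k + a ∧ e' (2 * k + 1) = e k + (a + t) := by
  let f : ℤ → Fin d → ℤ := fun k => e (k / 2) + if k % 2 = 0 then a else a + t
  have hs : ∀ k : ℤ, k ∈ Ico (-(2 * m : ℤ)) (2 * m) → k / 2 ∈ Ico (-(m : ℤ)) m := by
    intro k hk; simp only [mem_Ico] at *; omega
  obtain ⟨e', he', hee'⟩ := exists_bijOn_Ico_latticeCube_extending hm'
    (s := Ico (-(2 * m : ℤ)) (2 * m)) (f := f)
    (fun k hk => by simp only [mem_Ico] at *; omega)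
    (fun k hk => by
      have h₁ := he.mapsTo (hs k hk)
      by_cases h₂ : k % 2 = 0
      · simpa only [f, if_pos h₂] using ha _ h₁
      · simpa only [f, if_neg h₂] using hat _ h₁)
    (fun k hk l hl hkl => by
      have hk₁ := he.mapsTo (hs k hk)
      have hl₁ := he.mapsTo (hs l hl)
      have key : ∀ x y : ℤ, e (x / 2) + a = e (y / 2) + (a + t) → e (x / 2) = e (y / 2) + t :=
        fun x y h => by linear_combination h
      by_cases h₂ : k % 2 = 0 <;> by_cases h₃ : l % 2 = 0 <;>
        simp only [f, h₂, h₃, if_true, if_false] at hkl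
      · have := he.injOn (hs k hk) (hs l hl) (add_right_cancel hkl); omega
      -- A left and a right half could share a label only if the cube met its translate by `t`.
      · exact absurd (key _ _ hkl ▸ hk₁) (ht _ hl₁)
      · exact absurd (key _ _ hkl.symm ▸ hl₁) (ht _ hk₁)
      · have := he.injOn (hs k hk) (hs l hl) (add_right_cancel hkl); omega)
  refine ⟨e', he', fun k hk => ⟨?_, ?_⟩⟩
  · rw [hee' (by simp only [mem_Ico] at *; omega)]
    simp [f]
  · rw [hee' (by simp only [mem_Ico] at *; omega)]
    have h₁ : (2 * k + 1) / 2 = k := by omega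
    have h₂ : (2 * k + 1) % 2 = 1 := by omega
    simp [f, h₁]

/-- Towers exist for any choice of vectors `t n`, depending on the sizes `h n`, that move the cubes
off themselves. -/
theorem DyadicTowers.exists_of_shifts {d : ℕ} (hd : d ≠ 0) (τ : ℕ → ℕ → Fin d → ℤ)
    (hτ : ∀ n h, ∀ f ∈ latticeCube d h, f + τ n h ∉ latticeCube d h) :
    ∃ R : DyadicTowers d, ∀ n, R.t n = τ n (R.h n) := by
  let M : ℕ → ℕ → ℕ := fun n h => ∑ i, (τ n h i).natAbs
  have hM : ∀ n h i, |τ n h i| ≤ M n h := fun n h i => by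
    rw [Int.abs_eq_natAbs]
    exact_mod_cast Finset.single_le_sum (f := fun i => (τ n h i).natAbs)
      (fun _ _ => Nat.zero_le _) (Finset.mem_univ i)
  -- `M n h` bounds the coordinates of the shift and `n` is the margin. The last term makes the
  -- towers exhaust the line; the factor 2 makes `h ^ d` even and gives `2 * m n ≤ m (n + 1)`.
  let h : ℕ → ℕ := fun n =>
    Nat.rec 2 (fun n h => 2 * (h + M n h + n + (n + 1) * 2 ^ (n + 1))) n
  have hsucc : ∀ n, h (n + 1) = 2 * (h n + M n (h n) + n + (n + 1) * 2 ^ (n + 1)) := fun n => rfl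
  have hpos : ∀ n, 0 < h n := by
    intro n
    cases n with
    | zero => exact Nat.two_pos
    | succ n => rw [hsucc]; positivity
  have heven : ∀ n, 2 ∣ h n := by
    intro n
    cases n with
    | zero => exact dvd_rfl
    | succ n => exact ⟨_, hsucc n⟩
  let m : ℕ → ℕ := fun n => h n ^ d / 2
  have hm : ∀ n, 2 * m n = h n ^ d := fun n => Nat.mul_div_cancel' (dvd_pow (heven n) hd)
  let a : ℕ → Fin d → ℤ := fun n _ => M n (h n) + n
  let t : ℕ → Fin d → ℤ := fun n => τ n (h n)
  have hleft : ∀ n, ∀ f ∈ latticeCube d (h n), ∀ γ : Fin d → ℤ, (∀ i, |γ i| ≤ n) →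
      f + a n + γ ∈ latticeCube d (h (n + 1)) := by
    intro n f hf γ hγ i
    have h₁ := abs_le.1 (hγ i)
    have h₂ := hf i
    have h₃ : (0 : ℤ) ≤ (n + 1) * 2 ^ (n + 1) := by positivity
    rw [hsucc]
    push_cast
    simp only [a, Pi.add_apply]
    omega
  have hright : ∀ n, ∀ f ∈ latticeCube d (h n), ∀ γ : Fin d → ℤ, (∀ i, |γ i| ≤ n) →
      f + (a n + t n) + γ ∈ latticeCube d (h (n + 1)) := by
    intro n f hf γ hγ i
    have h₁ := abs_le.1 (hγ i)
    have h₂ := hf i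
    have h₃ : (0 : ℤ) ≤ (n + 1) * 2 ^ (n + 1) := by positivity
    have h₄ := abs_le.1 (hM n (h n) i)
    rw [hsucc]
    push_cast
    simp only [a, t, Pi.add_apply]
    omega
  have htwo : ∀ n, 2 * m n ≤ m (n + 1) := by
    intro n
    have h₁ : 2 * h n ≤ h (n + 1) := by rw [hsucc]; omega
    have h₂ : 2 * h n ^ d ≤ h (n + 1) ^ d := calc
      2 * h n ^ d ≤ 2 ^ d * h n ^ d := Nat.mul_le_mul_right _ (Nat.le_self_pow hd 2)
      _ = (2 * h n) ^ d := (mul_pow _ _ _).symm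
      _ ≤ h (n + 1) ^ d := Nat.pow_le_pow_left h₁ d
    rw [← hm n, ← hm (n + 1)] at h₂
    omega
  have hexhaust : ∀ n, n * 2 ^ n ≤ m n := by
    intro n
    have h₁ : 2 * (n * 2 ^ n) ≤ h n := by
      cases n with
      | zero => simp
      | succ n => rw [hsucc]; omega
    have h₂ := h₁.trans (Nat.le_self_pow hd (h n))
    rw [← hm] at h₂
    omega
  obtain ⟨e₀, he₀, -⟩ := exists_bijOn_Ico_latticeCube_extending (hm 0) (f := 0)
    (empty_subset _) (mapsTo_empty _ _) (injOn_empty _)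
  have step : ∀ n (e : ℤ → Fin d → ℤ), BijOn e (Ico (-(m n : ℤ)) (m n)) (latticeCube d (h n)) →
      ∃ e' : ℤ → Fin d → ℤ,
        BijOn e' (Ico (-(m (n + 1) : ℤ)) (m (n + 1))) (latticeCube d (h (n + 1))) ∧
        ∀ k ∈ Ico (-(m n : ℤ)) (m n),
          e' (2 * k) = e k + a n ∧ e' (2 * k + 1) = e k + (a n + t n) := fun n e he =>
    exists_next_labelling he (htwo n) (hm (n + 1)) (hτ n (h n))
      (fun f hf => by simpa using hleft n f hf 0 (by simp))
      (fun f hf => by simpa using hright n f hf 0 (by simp))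
  choose! F hF using step
  let e : ℕ → ℤ → Fin d → ℤ := fun n => Nat.rec e₀ F n
  have he : ∀ n, BijOn (e n) (Ico (-(m n : ℤ)) (m n)) (latticeCube d (h n)) := by
    intro n
    induction n with
    | zero => exact he₀
    | succ n ih => exact (hF n (e n) ih).1
  exact ⟨{  h := h
            m := m
            a := a
            t := t
            e := e
            h_pos := hpos
            two_mul_le := htwo
            exhaust := hexhaust
            bijOn := he
            left_half := fun n k hk => ((hF n (e n) (he n)).2 k hk).1
            right_half := fun n k hk => ((hF n (e n) (he n)).2 k hk).2
            left_margin := hleft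
            right_margin := hright }, fun _ => rfl⟩

/-! ### Lattice shifts near given directions -/

lemma EuclideanSpace.norm_le_card_mul {d : ℕ} {v : EuclideanSpace ℝ (Fin d)} {C : ℝ} (hC : 0 ≤ C)
    (hv : ∀ i, |v i| ≤ C) : ‖v‖ ≤ d * C := by
  rw [EuclideanSpace.norm_eq, Real.sqrt_le_left (by positivity)]
  calc ∑ i, ‖v i‖ ^ 2 ≤ ∑ _i : Fin d, C ^ 2 :=
        Finset.sum_le_sum fun i _ => by
          rw [Real.norm_eq_abs]; exact pow_le_pow_left₀ (abs_nonneg _) (hv i) 2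
    _ = d * C ^ 2 := by simp
    _ ≤ (d : ℝ) ^ 2 * C ^ 2 := by
        gcongr
        exact_mod_cast Nat.le_self_pow two_ne_zero d
    _ = (d * C) ^ 2 := (mul_pow _ _ _).symm

@[simp] lemma latticePoint_apply {d : ℕ} (γ : Fin d → ℤ) (i : Fin d) :
    latticePoint γ i = (γ i : ℝ) := rfl

lemma latticePoint_add {d : ℕ} (γ γ' : Fin d → ℤ) :
    latticePoint (γ + γ') = latticePoint γ + latticePoint γ' := by ext; simp

lemma latticePoint_sub {d : ℕ} (γ γ' : Fin d → ℤ) :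
    latticePoint (γ - γ') = latticePoint γ - latticePoint γ' := by ext; simp

lemma norm_latticePoint_sub_le {d h : ℕ} {p q : Fin d → ℤ} (hp : p ∈ latticeCube d h)
    (hq : q ∈ latticeCube d h) : ‖latticePoint (q - p)‖ ≤ d * h := by
  refine EuclideanSpace.norm_le_card_mul (Nat.cast_nonneg h) fun i => ?_
  have h₁ := hp i
  have h₂ := hq i
  rw [latticePoint_apply, Pi.sub_apply, ← Int.cast_abs]
  have h₃ : |q i - p i| ≤ (h : ℤ) := abs_le.2 ⟨by omega, by omega⟩
  exact (Int.cast_le (R := ℝ).2 h₃).trans_eq (Int.cast_natCast h)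

/-- Every half-line comes arbitrarily close to lattice points arbitrarily far away. -/
lemma exists_dist_latticePoint_smul_lt {d : ℕ} (u : EuclideanSpace ℝ (Fin d)) (S : ℝ) {ε : ℝ}
    (hε : 0 < ε) : ∃ t : Fin d → ℤ, ∃ s : ℝ, S ≤ s ∧ dist (latticePoint t) (s • u) < ε := by
  set S' := max S 0 with hS'
  -- The remainders `y k` of the multiples of `S' • u` modulo the lattice are bounded, so two of
  -- them are within `ε`. The difference of the two multiples is then a multiple of `u` close to the
  -- lattice.
  let z : ℕ → Fin d → ℤ := fun k i => ⌊(k * S') * u i⌋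
  let y : ℕ → EuclideanSpace ℝ (Fin d) := fun k => ((k : ℝ) * S') • u - latticePoint (z k)
  have hy : ∀ k, y k ∈ Metric.closedBall (0 : EuclideanSpace ℝ (Fin d)) (d * 1) := by
    intro k
    rw [mem_closedBall_zero_iff]
    refine EuclideanSpace.norm_le_card_mul zero_le_one fun i => ?_
    have : y k i = Int.fract ((k * S') * u i) := rfl
    rw [this, abs_of_nonneg (Int.fract_nonneg _)]
    exact (Int.fract_lt_one _).le
  obtain ⟨b, -, φ, hφ, hlim⟩ := tendsto_subseq_of_bounded Metric.isBounded_closedBall hy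
  obtain ⟨N, hN⟩ := Metric.cauchySeq_iff'.1 hlim.cauchySeq ε hε
  have hlt : φ N + 1 ≤ φ (N + 1) := hφ N.lt_succ_self
  have hlt' : (φ N : ℝ) + 1 ≤ φ (N + 1) := by exact_mod_cast hlt
  refine ⟨z (φ (N + 1)) - z (φ N), (φ (N + 1) - φ N) * S', ?_, ?_⟩
  · nlinarith [le_max_left S 0, le_max_right S 0]
  · have h := hN (N + 1) N.le_succ
    have hyy : (((φ (N + 1) : ℝ) - φ N) * S') • u -
        latticePoint (z (φ (N + 1)) - z (φ N)) = y (φ (N + 1)) - y (φ N) := by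
      simp only [latticePoint_sub, y, sub_mul, sub_smul]
      abel
    rwa [dist_comm, dist_eq_norm, hyy, ← dist_eq_norm]

/-- In `d * h + 2`, the term `d * h` bounds differences of cube points. One unit absorbs the
distance from `t` to `s • u`, the other the distance from a return time to the line. Requiring also
`s * ‖u‖ > d * h + 2` moves the cube off itself. -/
lemma exists_shift {d : ℕ} {u : EuclideanSpace ℝ (Fin d)} (hu : u ≠ 0) {r : ℝ} (hr : 0 < r)
    (n h : ℕ) : ∃ t : Fin d → ℤ, (∀ f ∈ latticeCube d h, f + t ∉ latticeCube d h) ∧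
      ∃ s : ℝ, 0 < s ∧ d * h + 2 < r * s ∧ dist (latticePoint t) (s • u) < 1 / (n + 1) := by
  have hu' : 0 < ‖u‖ := norm_pos_iff.2 hu
  obtain ⟨t, s, hs, hts⟩ := exists_dist_latticePoint_smul_lt u
    (1 + (d * h + 2) / r + (d * h + 2) / ‖u‖) (ε := 1 / (n + 1)) (by positivity)
  have h₁ : 0 < (d * h + 2) / r := by positivity
  have h₂ : 0 < (d * h + 2) / ‖u‖ := by positivity
  refine ⟨t, fun f hf hft => ?_, s, by linarith, ?_, hts⟩
  · have h₃ := norm_latticePoint_sub_le hf hft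
    rw [add_sub_cancel_left] at h₃
    have h₄ : d * h + 2 < ‖u‖ * s := (div_lt_iff₀' hu').1 (by linarith)
    have h₅ : ‖s • u‖ = s * ‖u‖ := by rw [norm_smul, Real.norm_of_nonneg (by linarith)]
    have h₆ : (1 : ℝ) / (n + 1) ≤ 1 := by
      rw [div_le_one (by positivity)]; linarith [Nat.cast_nonneg (α := ℝ) n]
    have h₇ := norm_sub_norm_le (s • u) (latticePoint t)
    rw [dist_comm, dist_eq_norm] at hts
    linarith
  · exact (div_lt_iff₀' hr).1 (by linarith)

/-- For nonzero vectors `u n` and radii `r n > 0` there is a free action of rank one that is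
recurrent along the lines through infinitely many `u n`, and only along lines that meet
infinitely many of the balls of centre `u n` and radius `r n`. -/
theorem exists_action_of_directions {d : ℕ} (hd : d ≠ 0) {u : ℕ → EuclideanSpace ℝ (Fin d)}
    (hu : ∀ n, u n ≠ 0) {r : ℕ → ℝ} (hr : ∀ n, 0 < r n) :
    ∃ T : InfiniteMPAction d, T.IsRankOne ∧ T.IsFree ∧
      (∀ θ : ProjSpace d, (∃ᶠ n in atTop, u n ∈ θ.submodule) → T.IsRecurrentAlong θ) ∧
      (∀ θ : ProjSpace d, T.IsRecurrentAlong θ →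
        ∃ᶠ n in atTop, ∃ g ∈ θ.submodule, dist g (u n) < r n) := by
  choose τ hτ s hs hsr hdist using fun n h => exists_shift (hu n) (hr n) n h
  obtain ⟨R, hR⟩ := DyadicTowers.exists_of_shifts hd τ hτ
  have h₀ : ∀ n, (0 : Fin d → ℤ) ∈ latticeCube d (R.h n) :=
    fun n i => ⟨le_rfl, by simpa using R.h_pos n⟩
  refine ⟨R.action, R.isRankOne_action, R.isFree_action, fun θ hθ ε hε A hA hA' => ?_,
    fun θ hθ => frequently_atTop.2 fun n => ?_⟩
  · have hlim : ∀ᶠ n : ℕ in atTop, (1 : ℝ) / (n + 1) < ε :=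
      tendsto_one_div_add_atTop_nhds_zero_nat.eventually_lt_const hε
    obtain ⟨n, hn, hnε, hpos⟩ :=
      (hθ.and_eventually (hlim.and (R.eventually_volume_inter_image_act_t_pos hA hA'))).exists
    refine ⟨R.t n, fun h => ?_, s n (R.h n) • u n, θ.submodule.smul_mem _ hn, ?_, hpos⟩
    · refine hτ n (R.h n) 0 (h₀ n) ?_
      rw [← hR, h, add_zero]
      exact h₀ n
    · rw [hR]
      exact (hdist n (R.h n)).trans hnε
  -- Testing recurrence with `ε = 1` on the base of stage `n` suffices: dividing by `s` shrinks the
  -- total error below `r k`.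
  · obtain ⟨γ, hγ, g, hg, hgγ, hpos⟩ := hθ 1 one_pos (R.level n 0)
      (DyadicTowers.measurableSet_level n 0)
      (lt_of_lt_of_eq (ENNReal.ofReal_pos.2 (by positivity))
        (DyadicTowers.volume_level (h₀ n)).symm)
    obtain ⟨k, hk, p, hp, q, hq, h⟩ := R.exists_eq_t_add_of_level_inter_nonempty hγ
      (nonempty_of_measure_ne_zero hpos.ne')
    have key : ∃ g' ∈ θ.submodule, ‖g' - latticePoint (R.t k)‖ < d * R.h k + 1 := by
      have hpq := norm_latticePoint_sub_le hp hq
      rw [dist_eq_norm] at hgγ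
      rcases h with rfl | rfl
      · refine ⟨g, hg, ?_⟩
        rw [latticePoint_add] at hgγ
        have := norm_sub_le (latticePoint (q - p))
          (latticePoint (q - p) + latticePoint (R.t k) - g)
        rw [show latticePoint (q - p) - (latticePoint (q - p) + latticePoint (R.t k) - g) =
          g - latticePoint (R.t k) by abel] at this
        linarith
      · refine ⟨-g, θ.submodule.neg_mem hg, ?_⟩
        rw [latticePoint_sub (q - p)] at hgγ
        have := norm_sub_le (latticePoint (q - p) - latticePoint (R.t k) - g)
          (latticePoint (q - p))
        rw [show latticePoint (q - p) - latticePoint (R.t k) - g - latticePoint (q - p) =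
          -g - latticePoint (R.t k) by abel] at this
        linarith
    obtain ⟨g', hg', hgt⟩ := key
    have hs' := hs k (R.h k)
    have h₁ := hdist k (R.h k)
    have h₂ : (1 : ℝ) / (k + 1) ≤ 1 := by
      rw [div_le_one (by positivity)]; linarith [Nat.cast_nonneg (α := ℝ) k]
    rw [← hR, dist_eq_norm] at h₁
    refine ⟨k, hk, (s k (R.h k))⁻¹ • g', θ.submodule.smul_mem _ hg', ?_⟩
    have h₃ : dist ((s k (R.h k))⁻¹ • g') (u k) =
        (s k (R.h k))⁻¹ * ‖g' - s k (R.h k) • u k‖ := by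
      rw [dist_eq_norm, ← norm_smul_of_nonneg (inv_nonneg.2 hs'.le), smul_sub, smul_smul,
        inv_mul_cancel₀ hs'.ne', one_smul]
    rw [h₃, inv_mul_lt_iff₀ hs', mul_comm]
    have h₄ := norm_sub_le_norm_sub_add_norm_sub g' (latticePoint (R.t k)) (s k (R.h k) • u k)
    have h₅ := hsr k (R.h k)
    linarith

/-! ### Topology of projective space -/

/-- The cone of nonzero vectors spanning lines of `O` is open in `V`, so it contains a ball about
the representative of `θ`. -/
lemma Projectivization.exists_ball_subset_of_isOpen {V : Type*} [NormedAddCommGroup V]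
    [NormedSpace ℝ V] {O : Set (ℙ ℝ V)} (hO : IsOpen O) {θ : ℙ ℝ V} (hθ : θ ∈ O) :
    ∃ r > 0, ∀ η : ℙ ℝ V, (∃ g ∈ η.submodule, dist g θ.rep < r) → η ∈ O := by
  have h : IsOpen (Subtype.val '' (Projectivization.mk' ℝ (V := V) ⁻¹' O)) :=
    isOpen_ne.isOpenMap_subtype_val _ (isOpen_coinduced.1 hO)
  obtain ⟨r, hr, hball⟩ := Metric.isOpen_iff.1 h θ.rep
    ⟨⟨θ.rep, θ.rep_nonzero⟩, by simpa [Projectivization.mk_rep] using hθ, rfl⟩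
  refine ⟨r, hr, ?_⟩
  rintro η ⟨g, hg, hgr⟩
  obtain ⟨⟨g, hg₀⟩, hgO, rfl⟩ := hball hgr
  have hη : η = Projectivization.mk ℝ g hg₀ := by
    rw [← η.mk_rep, Projectivization.mk_eq_mk_iff']
    rw [Projectivization.submodule_eq, Submodule.mem_span_singleton] at hg
    obtain ⟨a, rfl⟩ := hg
    have ha : a ≠ 0 := fun h => hg₀ (by simp [h])
    exact ⟨a⁻¹, by simp [smul_smul, ha]⟩
  rw [hη]
  exact hgO

/-- The lines along which the ratio of the coordinates `j` and `i` exceeds `n` form an open set. -/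
lemma isOpen_setOf_steeper {d : ℕ} (i j : Fin d) (n : ℕ) :
    IsOpen {θ : ProjSpace d | n * θ.rep i ^ 2 < θ.rep i * θ.rep j} := by
  rw [isOpen_coinduced]
  have h : (Projectivization.mk' ℝ ⁻¹' {θ : ProjSpace d | n * θ.rep i ^ 2 < θ.rep i * θ.rep j}) =
      {v | (n : ℝ) * v.1 i ^ 2 < v.1 i * v.1 j} := by
    ext ⟨v, hv⟩
    obtain ⟨a, ha⟩ := Projectivization.exists_smul_eq_mk_rep ℝ v hv
    have ha₀ : 0 < (a : ℝ) ^ 2 := by have := a.ne_zero; positivity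
    simp only [mem_preimage, mem_ofPred_eq, Projectivization.mk'_eq_mk, ← ha, Units.smul_def,
      PiLp.smul_apply, smul_eq_mul]
    rw [show (n : ℝ) * ((a : ℝ) * v i) ^ 2 = (a : ℝ) ^ 2 * (n * v i ^ 2) by ring,
      show (a : ℝ) * v i * (a * v j) = (a : ℝ) ^ 2 * (v i * v j) by ring]
    exact mul_lt_mul_iff_right₀ ha₀
  rw [h]
  exact isOpen_lt (by fun_prop) (by fun_prop)

/-- The matrix of the orthogonal projection to a line. -/
noncomputable def projectionMatrix {d : ℕ} (θ : ProjSpace d) (i j : Fin d) : ℝ :=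
  θ.rep i * θ.rep j / ‖θ.rep‖ ^ 2

lemma continuous_projectionMatrix {d : ℕ} : Continuous (projectionMatrix (d := d)) := by
  refine continuous_coinduced_dom.2 (continuous_pi fun i => continuous_pi fun j => ?_)
  have h : (fun v => (projectionMatrix ∘ Projectivization.mk' ℝ) v i j) =
      fun v : {v : EuclideanSpace ℝ (Fin d) // v ≠ 0} => v.1 i * v.1 j / ‖v.1‖ ^ 2 := by
    ext ⟨v, hv⟩
    obtain ⟨a, ha⟩ := Projectivization.exists_smul_eq_mk_rep ℝ v hv
    have ha₀ := a.ne_zero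
    have hv₀ := norm_ne_zero_iff.2 hv
    simp only [Function.comp, projectionMatrix, Projectivization.mk'_eq_mk, ← ha, Units.smul_def,
      PiLp.smul_apply, smul_eq_mul, norm_smul, Real.norm_eq_abs, mul_pow, sq_abs]
    field_simp
  rw [h]
  refine Continuous.div (by fun_prop) (by fun_prop) fun v => ?_
  have := norm_ne_zero_iff.2 v.2
  positivity

/-- A column of the matrix at a nonzero coordinate `j` of `θ` determines the representative up to a
scalar. -/
lemma injective_projectionMatrix {d : ℕ} : Function.Injective (projectionMatrix (d := d)) := by
  intro θ η h
  obtain ⟨j, hj⟩ : ∃ j, θ.rep j ≠ 0 := by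
    by_contra! h₀
    exact θ.rep_nonzero (by ext j; simpa using h₀ j)
  have h₁ := norm_ne_zero_iff.2 θ.rep_nonzero
  have h₂ := norm_ne_zero_iff.2 η.rep_nonzero
  rw [← θ.mk_rep, ← η.mk_rep, Projectivization.mk_eq_mk_iff']
  refine ⟨‖θ.rep‖ ^ 2 * η.rep j / (θ.rep j * ‖η.rep‖ ^ 2), ?_⟩
  ext i
  have h₃ := congrFun (congrFun h i) j
  simp only [projectionMatrix] at h₃
  rw [div_eq_div_iff (by positivity) (by positivity)] at h₃
  rw [PiLp.smul_apply, smul_eq_mul, div_mul_eq_mul_div, div_eq_iff (by positivity)]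
  linarith

/-- The matrix space is metric, so the compact image of `K` is closed and `Gδ` there; injectivity
pulls this back to `K`. -/
lemma IsCompact.isGδ_projSpace {d : ℕ} {K : Set (ProjSpace d)} (hK : IsCompact K) : IsGδ K := by
  rw [← injective_projectionMatrix.preimage_image K]
  exact (hK.image continuous_projectionMatrix).isClosed.isGδ.preimage continuous_projectionMatrix

/-- A countable subset `D` of a `Gδ` set `Δ` is exhausted by a sequence of points `p n` of open
sets `O n` whose upper limit is in `Δ`. -/
lemma exists_points_of_isGδ {d : ℕ} (hd : 2 ≤ d) {Δ D : Set (ProjSpace d)} (hΔ : IsGδ Δ)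
    (hD : D.Countable) (hDΔ : D ⊆ Δ) :
    ∃ (O : ℕ → Set (ProjSpace d)) (p : ℕ → ProjSpace d), (∀ n, IsOpen (O n)) ∧
      (∀ n, p n ∈ O n) ∧ (∀ θ ∈ D, ∃ᶠ n in atTop, p n = θ) ∧
      ∀ θ, (∃ᶠ n in atTop, θ ∈ O n) → θ ∈ Δ := by
  rcases Δ.eq_empty_or_nonempty with rfl | ⟨δ, hδ⟩
  -- For empty `Δ`, nonempty open sets with empty upper limit are needed: lines whose slope in the
  -- plane of two distinct coordinates exceeds `n`. This is where `2 ≤ d` enters.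
  · let i : Fin d := ⟨0, by omega⟩
    let j : Fin d := ⟨1, by omega⟩
    have hij : i ≠ j := by simp [i, j]
    have hp : ∀ n : ℕ, ∃ θ : ProjSpace d, n * θ.rep i ^ 2 < θ.rep i * θ.rep j := by
      intro n
      let v : EuclideanSpace ℝ (Fin d) := WithLp.toLp 2 fun k => if k = i then 1 else n + 1
      have hvi : v i = 1 := by simp [v]
      have hvj : v j = n + 1 := by simp [v, hij.symm]
      have hv : v ≠ 0 := fun h => by simp [h] at hvi
      obtain ⟨a, ha⟩ := Projectivization.exists_smul_eq_mk_rep ℝ v hv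
      have ha₀ : 0 < (a : ℝ) ^ 2 := by have := a.ne_zero; positivity
      refine ⟨Projectivization.mk ℝ v hv, ?_⟩
      simp only [← ha, Units.smul_def, PiLp.smul_apply, smul_eq_mul, hvi, hvj]
      nlinarith
    choose p hp using hp
    refine ⟨fun n => {θ | n * θ.rep i ^ 2 < θ.rep i * θ.rep j}, p,
      fun n => isOpen_setOf_steeper i j n, hp, fun θ hθ => absurd (hDΔ hθ) (notMem_empty θ),
      fun θ hθ => ?_⟩
    obtain ⟨N, hN⟩ := exists_nat_ge (θ.rep j / θ.rep i)
    obtain ⟨n, hn, h⟩ := frequently_atTop.1 hθ N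
    simp only [mem_ofPred_eq] at h
    have h₀ : θ.rep i ≠ 0 := fun h₀ => by simp [h₀] at h
    have h₁ : (N : ℝ) ≤ n := by exact_mod_cast hn
    have h₂ : θ.rep i * θ.rep j = θ.rep j / θ.rep i * θ.rep i ^ 2 := by field_simp
    rw [h₂] at h
    exact absurd (lt_of_mul_lt_mul_right h (sq_nonneg _)) (hN.trans h₁).not_gt
  · obtain ⟨W, hW, rfl⟩ := isGδ_iff_eq_iInter_nat.1 hΔ
    -- Adding `δ` ensures that the set to enumerate is nonempty even if `D` is empty.
    obtain ⟨q, hq⟩ := (hD.insert δ).exists_eq_range (insert_nonempty δ D)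
    have hqW : ∀ n, q n ∈ ⋂ k, W k := fun n => by
      have h : q n ∈ insert δ D := hq ▸ mem_range_self n
      exact insert_subset hδ hDΔ h
    -- The first component of `Nat.unpair` takes each value infinitely often, so every point of `D`
    -- recurs. The finite intersections decrease, so their upper limit is `⋂ k, W k`.
    refine ⟨fun n => ⋂ k ∈ Iic n, W k, fun n => q n.unpair.1,
      fun n => (finite_Iic n).isOpen_biInter fun k _ => hW k,
      fun n => mem_iInter₂.2 fun k _ => mem_iInter.1 (hqW _) k, fun θ hθ => ?_, fun θ hθ => ?_⟩
    · obtain ⟨k, rfl⟩ : θ ∈ range q := hq ▸ mem_insert_of_mem δ hθ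
      exact frequently_atTop.2 fun n => ⟨Nat.pair k n, Nat.right_le_pair k n, by simp⟩
    · refine mem_iInter.2 fun k => ?_
      obtain ⟨n, hn, h⟩ := frequently_atTop.1 hθ k
      exact mem_iInter₂.1 h k hn

/-! ### Assembly of the theorem -/

theorem exists_action_of_isGδ {d : ℕ} (hd : 2 ≤ d) {Δ D : Set (ProjSpace d)} (hΔ : IsGδ Δ)
    (hD : D.Countable) (hDΔ : D ⊆ Δ) :
    ∃ T : InfiniteMPAction d, T.IsRankOne ∧ T.IsFree ∧
      D ⊆ T.recurrenceSet ∧ T.recurrenceSet ⊆ Δ := by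
  obtain ⟨O, p, hO, hpO, hpD, hOΔ⟩ := exists_points_of_isGδ hd hΔ hD hDΔ
  choose r hr hball using fun n => Projectivization.exists_ball_subset_of_isOpen (hO n) (hpO n)
  obtain ⟨T, hT₁, hT₂, hT₃, hT₄⟩ := exists_action_of_directions (by omega : d ≠ 0)
    (fun n => (p n).rep_nonzero) hr
  refine ⟨T, hT₁, hT₂, fun θ hθ => hT₃ θ ((hpD θ hθ).mono ?_),
    fun θ hθ => hOΔ θ ((hT₄ θ hθ).mono fun n hn => hball n θ hn)⟩
  rintro n rfl
  rw [Projectivization.submodule_eq]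
  exact Submodule.mem_span_singleton_self _

theorem theorem4p2 (d : ℕ) (hd : 2 ≤ d) :
    (∀ Δ D : Set (ProjSpace d), IsGδ Δ → D.Countable → D ⊆ Δ →
      ∃ T : InfiniteMPAction d, T.IsRankOne ∧ T.IsFree ∧
        D ⊆ T.recurrenceSet ∧ T.recurrenceSet ⊆ Δ) ∧
    (∀ Δ : Set (ProjSpace d), IsGδ Δ → Δ.Countable →
      ∃ T : InfiniteMPAction d, T.IsRankOne ∧ T.IsFree ∧ T.recurrenceSet = Δ) ∧
    (∀ K : Set (ProjSpace d), IsCompact K → K.Countable →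
      ∃ T : InfiniteMPAction d, T.IsRankOne ∧ T.IsFree ∧ T.recurrenceSet = K) := by
  have key : ∀ Δ : Set (ProjSpace d), IsGδ Δ → Δ.Countable →
      ∃ T : InfiniteMPAction d, T.IsRankOne ∧ T.IsFree ∧ T.recurrenceSet = Δ := by
    intro Δ hΔ hΔ'
    obtain ⟨T, h₁, h₂, h₃, h₄⟩ := exists_action_of_isGδ hd hΔ hΔ' Subset.rfl
    exact ⟨T, h₁, h₂, h₄.antisymm h₃⟩
  exact ⟨fun Δ D hΔ hD hDΔ => exists_action_of_isGδ hd hΔ hD hDΔ, key,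
    fun K hK hK' => key K hK.isGδ_projSpace hK'⟩
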